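/- A \emph{binary functional graph of size $n$} is a map $f:\{1,\dots,n\}\to\{1,\dots,n\}$ such that every $y$ has exactly $0$ or $2$ preimages under $f$; such maps exist only for even $n$. For a node $x$, the \emph{tail length} of $x$ is the least $i\ge 0$ with $f^i(x)=f^j(x)$ for some $j>i$; the \emph{cycle length} of $x$ is the number of edges of the cycle through $f^i(x)$ for this $i$; the \emph{rho length} of $x$ is the sum of its tail length and its cycle length. For $r\ge 0$ let $C_{n,r}$, $T_{n,r}$, $R_{n,r}$ be the means, over a uniformly random binary functional graph of size $n$, of the number of nodes $x$ whose cycle length, tail length, rho length, respectively, equals $r$. Then for every fixed integer $r\ge 0$, as $n\to\infty$ through the even integers: (1) cycle lengths: if $r\ge 1$, then $C_{n,r}\sim\sqrt{\pi n/2}-r$ (the ratio tends to $1$), and, to second order, $C_{n,r}=\sqrt{\pi n/2}-r+1+o(1)$; (2) tail lengths: $T_{n,r}\sim\sqrt{\pi n/2}-r+1$, and, to second order, if $r\ge 1$, then $T_{n,r}=\sqrt{\pi n/2}-r+o(1)$; (3) rho lengths: $R_{n,r}\to r$. -/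

import Mathlib

open Filter Topology Asymptotics

noncomputable section

namespace BinaryFunctionalGraph

/-- The functional graph of `f` is binary: every node has in-degree `0` or `2`. -/
def IsBinary {n : ℕ} (f : Fin n → Fin n) : Prop :=
  ∀ y, (Finset.univ.filter fun x => f x = y).card = 0 ∨
    (Finset.univ.filter fun x => f x = y).card = 2

open Classical in
/-- The (labelled) binary functional graphs of size `n`. -/
def graphs (n : ℕ) : Finset (Fin n → Fin n) :=
  Finset.univ.filter fun f => IsBinary f

/-- Tail length as seen from `x`: the least `i` such that the `i`-th iterate of `x` is
visited again later on. -/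
def tailLength {n : ℕ} (f : Fin n → Fin n) (x : Fin n) : ℕ :=
  sInf {i | ∃ j, i < j ∧ f^[i] x = f^[j] x}

/-- Cycle length as seen from `x`: the number of edges from the node where the tail of `x`
meets the cycle back to that node. -/
def cycleLength {n : ℕ} (f : Fin n → Fin n) (x : Fin n) : ℕ :=
  Function.minimalPeriod f (f^[tailLength f x] x)

/-- Rho length as seen from `x`. -/
def rhoLength {n : ℕ} (f : Fin n → Fin n) (x : Fin n) : ℕ :=
  tailLength f x + cycleLength f x

/-- The number of nodes of the functional graph of `f` whose cycle length is `r`. -/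
def cycleCount (r : ℕ) {n : ℕ} (f : Fin n → Fin n) : ℕ :=
  (Finset.univ.filter fun x => cycleLength f x = r).card

/-- The number of nodes of the functional graph of `f` whose tail length is `r`. -/
def tailCount (r : ℕ) {n : ℕ} (f : Fin n → Fin n) : ℕ :=
  (Finset.univ.filter fun x => tailLength f x = r).card

/-- The number of nodes of the functional graph of `f` whose rho length is `r`. -/
def rhoCount (r : ℕ) {n : ℕ} (f : Fin n → Fin n) : ℕ :=
  (Finset.univ.filter fun x => rhoLength f x = r).card

/-- The mean of `X` over a uniformly random binary functional graph of size `n`. It is meant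
for even `n` only: there is no binary functional graph of odd size. -/
def mean (n : ℕ) (X : (Fin n → Fin n) → ℕ) : ℝ :=
  (∑ f ∈ graphs n, (X f : ℝ)) / ((graphs n).card : ℝ)

/-- `n → ∞` through the even numbers. -/
def evenAtTop : Filter ℕ := atTop ⊓ 𝓟 {n | Even n}

end BinaryFunctionalGraph

end

/-! Count pairs `(f, x)`. For `n = 2 * m` let `N` be the number of graphs, `L k` the number of pairs
whose first `k` iterates are distinct, `S t c` the number with tail length `t` and cycle length `c`,
and `w k = weight m k`.

Composing with a transposition keeps a graph binary. On the left it gives `S 0 (k+1) * (n-k-1) = L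
(k+2)` (`card_shapePairs_zero_mul`). On the right, using that every node has exactly one sibling, it
gives `S (t+1) (c+1) * (n-t-c-1) = L (t+c+2)` (`card_shapePairs_succ_mul`). An orbit that does not
continue closes up, so `L k = L (k+1) + ∑ t < k, S t (k-t)` (`card_longPairs_eq`). The resulting
recursion has the solution `S 0 c = N * w c` for `c ≥ 1` and `S t c = N * w (t+c-1)` for `t, c ≥ 1`.

The means are therefore sums of weights: `w r + ∑ k ≥ r, w k` for cycle length `r ≥ 1`, `∑ k ≥ max r
1, w k` for tail length `r`, and `(r-1) * w (r-1) + w r` for rho length `r ≥ 1`. Each `w k` tends to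
`1`, and the full sum is `4 ^ m / m.centralBinom` (`sum_weight`), which is `√(π m) + o(1)` by
Wallis' product. -/

namespace BinaryFunctionalGraph

open Finset Function

/-! ### Iterates, tails and cycles -/

/-- If `g` agrees with `f` along the first steps of the orbit of `x`, the orbits agree. -/
lemma iterate_eq_of_agree {α : Type*} {f g : α → α} {x : α} {k : ℕ}
    (h : ∀ i < k, g (f^[i] x) = f (f^[i] x)) : ∀ i ≤ k, g^[i] x = f^[i] x := by
  intro i
  induction i with
  | zero => intro _; rfl
  | succ i ih =>
    intro hi
    rw [iterate_succ_apply', iterate_succ_apply', ih (by omega), h i (by omega)]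

lemma injOn_iterate_of_agree {α : Type*} {f g : α → α} {x : α} {k : ℕ}
    (h : ∀ i < k, g^[i] x = f^[i] x) (hf : Set.InjOn (fun i => f^[i] x) (Set.Iio k)) :
    Set.InjOn (fun i => g^[i] x) (Set.Iio k) := by
  intro i hi j hj hij
  simp only [h i hi, h j hj] at hij
  exact hf hi hj hij

lemma exists_iterate_eq {n : ℕ} (f : Fin n → Fin n) (x : Fin n) :
    {i | ∃ j, i < j ∧ f^[i] x = f^[j] x}.Nonempty := by
  obtain ⟨i, j, hne, h⟩ := Finite.exists_ne_map_eq_of_infinite (fun i : ℕ => f^[i] x)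
  rcases lt_or_gt_of_ne hne with hlt | hlt
  · exact ⟨i, j, hlt, h⟩
  · exact ⟨j, i, hlt, h.symm⟩

lemma cycleLength_pos {n : ℕ} (f : Fin n → Fin n) (x : Fin n) : 0 < cycleLength f x := by
  obtain ⟨j, hj, h⟩ := Nat.sInf_mem (exists_iterate_eq f x)
  refine IsPeriodicPt.minimalPeriod_pos (n := j - tailLength f x) (Nat.sub_pos_of_lt hj) ?_
  change f^[j - tailLength f x] (f^[tailLength f x] x) = _
  have hj' : tailLength f x ≤ j := hj.le
  rw [← iterate_add_apply, Nat.sub_add_cancel hj']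
  exact h.symm

/-- Replaces the infimum and the minimal period by distinctness plus one closing equation, the form
in which the bijections below can be checked. -/
lemma tail_cycle_iff {n : ℕ} (f : Fin n → Fin n) (x : Fin n) {t c : ℕ} (hc : 0 < c) :
    (tailLength f x = t ∧ cycleLength f x = c) ↔
      Set.InjOn (fun i => f^[i] x) (Set.Iio (t + c)) ∧ f^[t + c] x = f^[t] x := by
  constructor
  · rintro ⟨rfl, rfl⟩
    constructor
    · have key : ∀ i j, i < j → j < tailLength f x + cycleLength f x →
          f^[i] x ≠ f^[j] x := by
        intro i j hij hj h
        have hi : tailLength f x ≤ i := Nat.sInf_le ⟨j, hij, h⟩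
        obtain ⟨a, rfl⟩ := Nat.exists_eq_add_of_le hi
        obtain ⟨b, rfl⟩ := Nat.exists_eq_add_of_le (hi.trans hij.le)
        rw [add_comm _ a, add_comm _ b, iterate_add_apply, iterate_add_apply] at h
        have := iterate_injOn_Iio_minimalPeriod (f := f) (x := f^[tailLength f x] x)
          (show a < cycleLength f x by omega) (show b < cycleLength f x by omega) h
        omega
      intro i hi j hj h
      rcases lt_trichotomy i j with hlt | heq | hlt
      · exact (key i j hlt hj h).elim
      · exact heq
      · exact (key j i hlt hi h.symm).elim
    · rw [add_comm, iterate_add_apply]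
      exact isPeriodicPt_minimalPeriod f _
  · rintro ⟨hinj, h⟩
    have hper : IsPeriodicPt f c (f^[t] x) := by
      change f^[c] (f^[t] x) = _
      rw [← iterate_add_apply, add_comm, h]
    have ht : tailLength f x = t := by
      refine le_antisymm (Nat.sInf_le ⟨t + c, by omega, h.symm⟩) ?_
      refine le_csInf (exists_iterate_eq f x) ?_
      rintro i ⟨j, hij, hj⟩
      by_contra! hit
      have hjt : t + c ≤ j := by
        by_contra! hlt
        have := hinj (show i < t + c by omega) hlt hj
        omega
      -- Periodicity brings a late visit `j` back into the window `[t, t + c)`, where injectivity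
      -- excludes a match with `i < t`.
      have hmod : f^[j] x = f^[t + (j - t) % c] x := by
        conv_lhs => rw [show j = (j - t) + t by omega]
        rw [iterate_add_apply, ← hper.iterate_mod_apply, ← iterate_add_apply, add_comm]
      have hlt := Nat.mod_lt (j - t) hc
      have := hinj (show i < t + c by omega) (show t + (j - t) % c < t + c by omega)
        (hj.trans hmod)
      omega
    refine ⟨ht, ?_⟩
    unfold cycleLength
    rw [ht]
    have hp := hper.minimalPeriod_pos hc
    refine le_antisymm (hper.minimalPeriod_le hc) ?_
    by_contra! hlt
    have := hinj (show t + minimalPeriod f (f^[t] x) < t + c by omega) (show t < t + c by omega)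
      (by
        change f^[t + minimalPeriod f (f^[t] x)] x = f^[t] x
        rw [add_comm, iterate_add_apply]; exact isPeriodicPt_minimalPeriod f _)
    omega

/-! ### Symmetries of binary functional graphs -/

lemma mem_graphs {n : ℕ} {f : Fin n → Fin n} : f ∈ graphs n ↔ IsBinary f := by
  simp [graphs]

lemma IsBinary.equiv_comp {n : ℕ} {f : Fin n → Fin n} (hf : IsBinary f)
    (σ : Equiv.Perm (Fin n)) : IsBinary (σ ∘ f) := by
  intro y
  have : (univ.filter fun x => (σ ∘ f) x = y) = univ.filter fun x => f x = σ.symm y := by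
    ext x
    simp [Equiv.eq_symm_apply]
  rw [this]
  exact hf _

lemma IsBinary.comp_equiv {n : ℕ} {f : Fin n → Fin n} (hf : IsBinary f)
    (σ : Equiv.Perm (Fin n)) : IsBinary (f ∘ σ) := by
  intro y
  have : (univ.filter fun x => (f ∘ σ) x = y).card = (univ.filter fun x => f x = y).card :=
    Finset.card_equiv σ (by simp)
  rw [this]
  exact hf _

/-- In a binary graph every node has exactly one sibling. -/
lemma IsBinary.card_siblings {n : ℕ} {f : Fin n → Fin n} (hf : IsBinary f) (v : Fin n) :
    (univ.filter fun z => z ≠ v ∧ f z = f v).card = 1 := by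
  have hv : v ∈ univ.filter fun x => f x = f v := by simp
  have h2 : (univ.filter fun x => f x = f v).card = 2 :=
    (hf (f v)).resolve_left (card_pos.mpr ⟨v, hv⟩).ne'
  have : (univ.filter fun z => z ≠ v ∧ f z = f v) = (univ.filter fun x => f x = f v).erase v := by
    ext z; simp
  rw [this, card_erase_of_mem hv, h2]

lemma graphs_two_mul_nonempty (m : ℕ) : (graphs (2 * m)).Nonempty := by
  refine ⟨fun i => ⟨i / 2, by omega⟩, mem_graphs.mpr fun y => ?_⟩
  rcases lt_or_ge (y : ℕ) m with hy | hy
  · right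
    have : (univ.filter fun x : Fin (2 * m) => (⟨x / 2, by omega⟩ : Fin (2 * m)) = y) =
        {⟨2 * y, by omega⟩, ⟨2 * y + 1, by omega⟩} := by
      ext x
      simp only [mem_filter, mem_univ, true_and, mem_insert, mem_singleton, Fin.ext_iff]
      omega
    rw [this]
    exact card_pair (by simp [Fin.ext_iff])
  · left
    rw [card_eq_zero, filter_eq_empty_iff]
    intro x _
    simp only [Fin.ext_iff]
    omega

/-! ### Counting pairs by the shape of the orbit -/

open Classical in
/-- Pairs `(f, x)` for which `x, f x, …, f^[k - 1] x` are distinct. -/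
noncomputable def longPairs (n k : ℕ) : Finset ((Fin n → Fin n) × Fin n) :=
  (graphs n ×ˢ univ).filter fun p => Set.InjOn (fun i => p.1^[i] p.2) (Set.Iio k)

/-- Pairs `(f, x)` for which `x` has tail length `t` and cycle length `c` in `f`. -/
noncomputable def shapePairs (n t c : ℕ) : Finset ((Fin n → Fin n) × Fin n) :=
  (graphs n ×ˢ univ).filter fun p => tailLength p.1 p.2 = t ∧ cycleLength p.1 p.2 = c

lemma mem_longPairs {n k : ℕ} {p : (Fin n → Fin n) × Fin n} :
    p ∈ longPairs n k ↔ IsBinary p.1 ∧ Set.InjOn (fun i => p.1^[i] p.2) (Set.Iio k) := by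
  simp [longPairs, mem_graphs]

lemma mem_shapePairs {n t c : ℕ} (hc : 0 < c) {p : (Fin n → Fin n) × Fin n} :
    p ∈ shapePairs n t c ↔ IsBinary p.1 ∧ Set.InjOn (fun i => p.1^[i] p.2) (Set.Iio (t + c)) ∧
      p.1^[t + c] p.2 = p.1^[t] p.2 := by
  simp [shapePairs, mem_graphs, tail_cycle_iff _ _ hc]

lemma card_notMem_orbit {n k : ℕ} {f : Fin n → Fin n} {x : Fin n}
    (h : Set.InjOn (fun i => f^[i] x) (Set.Iio k)) :
    (univ.filter fun y => ∀ i < k, y ≠ f^[i] x).card + k = n := by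
  have : (univ.filter fun y => ∀ i < k, y ≠ f^[i] x) =
      ((range k).image fun i => f^[i] x)ᶜ := by
    ext y
    simp [eq_comm]
  rw [this, card_compl, card_image_of_injOn (by simpa using h), card_range, Fintype.card_fin]
  have := card_le_univ ((range k).image fun i => f^[i] x)
  rw [card_image_of_injOn (by simpa using h), card_range, Fintype.card_fin] at this
  omega

lemma longPairs_antitone (n : ℕ) : Antitone (longPairs n) := by
  intro a b hab p hp
  rw [mem_longPairs] at hp ⊢
  exact ⟨hp.1, hp.2.mono (Set.Iio_subset_Iio hab)⟩

lemma card_longPairs_one (n : ℕ) : (longPairs n 1).card = n * (graphs n).card := by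
  have : longPairs n 1 = graphs n ×ˢ univ := by
    ext p
    simp only [mem_longPairs, mem_product, mem_graphs, mem_univ, and_true, and_iff_left_iff_imp]
    intro _ i hi j hj _
    simp only [Set.mem_Iio] at hi hj
    omega
  rw [this, card_product, card_univ, Fintype.card_fin, mul_comm]

lemma shapePairs_subset_longPairs {n t c : ℕ} (hc : 0 < c) :
    shapePairs n t c ⊆ longPairs n (t + c) := by
  intro p hp
  rw [mem_shapePairs hc] at hp
  exact mem_longPairs.mpr ⟨hp.1, hp.2.1⟩

/-- Redirecting the closing edge of a cycle of length `k` through `x` to a node off the cycle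
gives every orbit of length at least `k + 1` exactly once. -/
lemma card_shapePairs_zero_mul (n k : ℕ) :
    ((shapePairs n 0 (k + 1)).card : ℝ) * (n - (k + 1)) = (longPairs n (k + 2)).card := by
  have hA : ∀ p ∈ shapePairs n 0 (k + 1),
      ((univ.filter fun y => ∀ i < k + 1, y ≠ p.1^[i] p.2).card : ℝ) = n - (k + 1) := by
    intro p hp
    have := card_notMem_orbit ((mem_shapePairs k.succ_pos).mp hp).2.1
    rw [zero_add] at this
    rw [eq_sub_iff_add_eq]
    exact_mod_cast this
  have hB : ∀ p ∈ longPairs n (k + 2),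
      (univ.filter fun y => y = p.1^[k + 1] p.2).card = 1 := by
    intro p _
    rw [filter_eq', if_pos (mem_univ _), card_singleton]
  have hcard : ((shapePairs n 0 (k + 1)).sigma fun p =>
        univ.filter fun y => ∀ i < k + 1, y ≠ p.1^[i] p.2).card =
      ((longPairs n (k + 2)).sigma fun p => univ.filter fun y => y = p.1^[k + 1] p.2).card := by
    -- The swap is its own inverse. It exchanges the whole fibres over `x` and `y`, so in-degrees
    -- stay `0` or `2`; on the orbit only the edge leaving `f^[k] x` changes.
    refine card_nbij' (fun q => ⟨(Equiv.swap q.1.2 q.2 ∘ q.1.1, q.1.2), q.2⟩)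
      (fun q => ⟨(Equiv.swap q.1.2 q.2 ∘ q.1.1, q.1.2), q.2⟩) ?_ ?_ ?_ ?_
    · rintro ⟨⟨f, x⟩, y⟩ hq
      simp only [coe_sigma, Set.mem_sigma_iff, mem_coe, mem_shapePairs k.succ_pos, mem_filter,
        mem_univ, true_and, zero_add, iterate_zero, id] at hq
      obtain ⟨⟨hb, hinj, hx⟩, hy⟩ := hq
      have hag : ∀ i ≤ k, (Equiv.swap x y ∘ f)^[i] x = f^[i] x := by
        refine iterate_eq_of_agree fun i hi => ?_
        rw [comp_apply, ← iterate_succ_apply' f]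
        refine Equiv.swap_apply_of_ne_of_ne (fun h => ?_) (hy _ (by omega)).symm
        have := hinj (show i + 1 < k + 1 by omega) (show 0 < k + 1 by omega) h
        omega
      have hlast : (Equiv.swap x y ∘ f)^[k + 1] x = y := by
        rw [iterate_succ_apply', hag k le_rfl, comp_apply, ← iterate_succ_apply' f, hx,
          Equiv.swap_apply_left]
      simp only [coe_sigma, Set.mem_sigma_iff, mem_coe, mem_longPairs, mem_filter, mem_univ,
        true_and]
      refine ⟨⟨hb.equiv_comp _, ?_⟩, hlast.symm⟩
      have h1 := injOn_iterate_of_agree (fun i hi => hag i (Nat.lt_succ_iff.mp hi)) hinj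
      have hne : ∀ i < k + 1, (Equiv.swap x y ∘ f)^[i] x ≠ (Equiv.swap x y ∘ f)^[k + 1] x := by
        intro i hi h
        rw [hlast, hag i (by omega)] at h
        exact hy i hi h.symm
      intro i hi j hj hij
      simp only [Set.mem_Iio] at hi hj
      rcases Nat.lt_or_ge i (k + 1) with hi' | hi' <;> rcases Nat.lt_or_ge j (k + 1) with hj' | hj'
      · exact h1 hi' hj' hij
      · obtain rfl : j = k + 1 := by omega
        exact (hne i hi' hij).elim
      · obtain rfl : i = k + 1 := by omega
        exact (hne j hj' hij.symm).elim
      · omega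
    · rintro ⟨⟨f, x⟩, y⟩ hq
      simp only [coe_sigma, Set.mem_sigma_iff, mem_coe, mem_longPairs, mem_filter, mem_univ,
        true_and] at hq
      obtain ⟨⟨hb, hinj⟩, hy⟩ := hq
      have hag : ∀ i ≤ k, (Equiv.swap x y ∘ f)^[i] x = f^[i] x := by
        refine iterate_eq_of_agree fun i hi => ?_
        rw [comp_apply, ← iterate_succ_apply' f]
        refine Equiv.swap_apply_of_ne_of_ne (fun h => ?_) (fun h => ?_)
        · have := hinj (show i + 1 < k + 2 by omega) (show 0 < k + 2 by omega) h
          omega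
        · have := hinj (show i + 1 < k + 2 by omega) (show k + 1 < k + 2 by omega) (h.trans hy)
          omega
      simp only [coe_sigma, Set.mem_sigma_iff, mem_coe, mem_shapePairs k.succ_pos, mem_filter,
        mem_univ, true_and, zero_add, iterate_zero, id]
      refine ⟨⟨hb.equiv_comp _, ?_, ?_⟩, fun i hi h => ?_⟩
      · exact injOn_iterate_of_agree (fun i hi => hag i (Nat.lt_succ_iff.mp hi))
          (hinj.mono (Set.Iio_subset_Iio (by omega)))
      · rw [iterate_succ_apply', hag k le_rfl, comp_apply, ← iterate_succ_apply' f, ← hy,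
          Equiv.swap_apply_right]
      · rw [hag i (by omega), hy] at h
        have := hinj (show k + 1 < k + 2 by omega) (show i < k + 2 by omega) h
        omega
    · rintro ⟨⟨f, x⟩, y⟩ _
      simp [← comp_assoc, ← Equiv.coe_trans]
    · rintro ⟨⟨f, x⟩, y⟩ _
      simp [← comp_assoc, ← Equiv.coe_trans]
  rw [card_sigma, card_sigma, sum_congr rfl hB] at hcard
  have hcard' := congrArg (Nat.cast : ℕ → ℝ) hcard
  push_cast at hcard'
  rw [sum_congr rfl hA, sum_const, nsmul_eq_mul] at hcard'
  rw [hcard', sum_const, nsmul_one]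

/-- Exchanging the last source of the orbit with the sibling of the node entering the cycle
relates orbits of length at least `k` to those that close up with tail length `t`. -/
lemma card_shapePairs_succ_mul (n t c : ℕ) :
    ((shapePairs n (t + 1) (c + 1)).card : ℝ) * (n - (t + c + 1)) =
      (longPairs n (t + c + 2)).card := by
  have hA : ∀ p ∈ shapePairs n (t + 1) (c + 1),
      ((univ.filter fun y => ∀ i < t + c + 1, y ≠ p.1^[i] p.2).card : ℝ) = n - (t + c + 1) := by
    intro p hp
    have := card_notMem_orbit (((mem_shapePairs c.succ_pos).mp hp).2.1.mono
      (Set.Iio_subset_Iio (show t + c + 1 ≤ t + 1 + (c + 1) by omega)))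
    rw [eq_sub_iff_add_eq]
    exact_mod_cast this
  have hB : ∀ p ∈ longPairs n (t + c + 2),
      (univ.filter fun z => z ≠ p.1^[t] p.2 ∧ p.1 z = p.1 (p.1^[t] p.2)).card = 1 :=
    fun p hp => (mem_longPairs.mp hp).1.card_siblings _
  have hcard : ((shapePairs n (t + 1) (c + 1)).sigma fun p =>
        univ.filter fun y => ∀ i < t + c + 1, y ≠ p.1^[i] p.2).card =
      ((longPairs n (t + c + 2)).sigma fun p =>
        univ.filter fun z => z ≠ p.1^[t] p.2 ∧ p.1 z = p.1 (p.1^[t] p.2)).card := by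
    have hag : ∀ (f : Fin n → Fin n) (x y : Fin n),
        Set.InjOn (fun i => f^[i] x) (Set.Iio (t + c + 2)) →
        (∀ i < t + c + 1, y ≠ f^[i] x) →
        ∀ i ≤ t + c + 1, (f ∘ Equiv.swap (f^[t + c + 1] x) y)^[i] x = f^[i] x := by
      intro f x y hinj hy
      refine iterate_eq_of_agree fun i hi => ?_
      rw [comp_apply, Equiv.swap_apply_of_ne_of_ne (fun h => ?_) (hy i hi).symm]
      have := hinj (show i < t + c + 2 by omega) (show t + c + 1 < t + c + 2 by omega) h
      omega
    have hsib : ∀ (f : Fin n → Fin n) (x z : Fin n),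
        Set.InjOn (fun i => f^[i] x) (Set.Iio (t + c + 2)) → z ≠ f^[t] x →
        f z = f (f^[t] x) → ∀ i < t + c + 1, z ≠ f^[i] x := by
      rintro f x z hinj hz hfz i hi rfl
      rw [← iterate_succ_apply' f, ← iterate_succ_apply' f] at hfz
      have := hinj (show i + 1 < t + c + 2 by omega) (show t + 1 < t + c + 2 by omega) hfz
      obtain rfl : i = t := by omega
      exact hz rfl
    -- After the swap `y` takes over the closing edge and becomes the sibling of `f^[t] x`, while
    -- `f^[t + c + 1] x` inherits the image of `y`. The choice `y = f^[t + c + 1] x` is allowed: the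
    -- swap is then trivial and the orbit stays closed. This is why `y` avoids only the first `t + c
    -- + 1` nodes.
    refine card_nbij'
      (fun q => ⟨(q.1.1 ∘ Equiv.swap (q.1.1^[t + c + 1] q.1.2) q.2, q.1.2), q.2⟩)
      (fun q => ⟨(q.1.1 ∘ Equiv.swap (q.1.1^[t + c + 1] q.1.2) q.2, q.1.2), q.2⟩) ?_ ?_ ?_ ?_
    · rintro ⟨⟨f, x⟩, y⟩ hq
      simp only [coe_sigma, Set.mem_sigma_iff, mem_coe, mem_shapePairs c.succ_pos, mem_filter,
        mem_univ, true_and, show t + 1 + (c + 1) = t + c + 2 by ring] at hq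
      obtain ⟨⟨hb, hinj, hx⟩, hy⟩ := hq
      have hg := hag f x y hinj hy
      simp only [coe_sigma, Set.mem_sigma_iff, mem_coe, mem_longPairs, mem_filter, mem_univ,
        true_and]
      refine ⟨⟨hb.comp_equiv _, injOn_iterate_of_agree
        (fun i hi => hg i (Nat.lt_succ_iff.mp hi)) hinj⟩, ?_, ?_⟩
      · rw [hg t (by omega)]
        exact hy t (by omega)
      · rw [← iterate_succ_apply' (f ∘ _), hg (t + 1) (by omega), comp_apply,
          Equiv.swap_apply_right, ← iterate_succ_apply' f, hx]
    · rintro ⟨⟨f, x⟩, y⟩ hq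
      simp only [coe_sigma, Set.mem_sigma_iff, mem_coe, mem_longPairs, mem_filter, mem_univ,
        true_and] at hq
      obtain ⟨⟨hb, hinj⟩, hy, hfy⟩ := hq
      have hg := hag f x y hinj (hsib f x y hinj hy hfy)
      simp only [coe_sigma, Set.mem_sigma_iff, mem_coe, mem_shapePairs c.succ_pos, mem_filter,
        mem_univ, true_and, show t + 1 + (c + 1) = t + c + 2 by ring]
      refine ⟨⟨hb.comp_equiv _, injOn_iterate_of_agree
        (fun i hi => hg i (Nat.lt_succ_iff.mp hi)) hinj, ?_⟩, fun i hi => ?_⟩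
      · rw [iterate_succ_apply', hg _ le_rfl, hg (t + 1) (by omega), comp_apply,
          Equiv.swap_apply_left, hfy, ← iterate_succ_apply' f]
      · rw [hg i hi.le]
        exact hsib f x y hinj hy hfy i hi
    · rintro ⟨⟨f, x⟩, y⟩ hq
      simp only [coe_sigma, Set.mem_sigma_iff, mem_coe, mem_shapePairs c.succ_pos, mem_filter,
        mem_univ, true_and, show t + 1 + (c + 1) = t + c + 2 by ring] at hq
      have hg := hag f x y hq.1.2.1 hq.2
      simp only [hg _ le_rfl]
      simp [-iterate_succ, comp_assoc, ← Equiv.coe_trans]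
    · rintro ⟨⟨f, x⟩, y⟩ hq
      simp only [coe_sigma, Set.mem_sigma_iff, mem_coe, mem_longPairs, mem_filter, mem_univ,
        true_and] at hq
      have hg := hag f x y hq.1.2 (hsib f x y hq.1.2 hq.2.1 hq.2.2)
      simp only [hg _ le_rfl]
      simp [-iterate_succ, comp_assoc, ← Equiv.coe_trans]
  rw [card_sigma, card_sigma, sum_congr rfl hB] at hcard
  have hcard' := congrArg (Nat.cast : ℕ → ℝ) hcard
  push_cast at hcard'
  rw [sum_congr rfl hA, sum_const, nsmul_eq_mul] at hcard'
  rw [hcard', sum_const, nsmul_one]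

/-- An orbit with `k` distinct initial nodes either continues or closes up. -/
lemma card_longPairs_eq (n k : ℕ) :
    (longPairs n k).card =
      (longPairs n (k + 1)).card + ∑ t ∈ range k, (shapePairs n t (k - t)).card := by
  have hunion : longPairs n k =
      longPairs n (k + 1) ∪ (range k).biUnion fun t => shapePairs n t (k - t) := by
    ext p
    simp only [mem_union, mem_biUnion, mem_range]
    constructor
    · intro hp
      by_cases h : ∃ t < k, p.1^[k] p.2 = p.1^[t] p.2
      · obtain ⟨t, ht, h⟩ := h
        refine Or.inr ⟨t, ht, (mem_shapePairs (by omega)).mpr ?_⟩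
        rw [Nat.add_sub_cancel' ht.le]
        exact ⟨(mem_longPairs.mp hp).1, (mem_longPairs.mp hp).2, h⟩
      · push Not at h
        refine Or.inl (mem_longPairs.mpr ⟨(mem_longPairs.mp hp).1, ?_⟩)
        intro i hi j hj hij
        simp only [Set.mem_Iio] at hi hj
        rcases Nat.lt_or_ge i k with hi' | hi' <;> rcases Nat.lt_or_ge j k with hj' | hj'
        · exact (mem_longPairs.mp hp).2 hi' hj' hij
        · obtain rfl : j = k := by omega
          exact (h i hi' hij.symm).elim
        · obtain rfl : i = k := by omega
          exact (h j hj' hij).elim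
        · omega
    · rintro (hp | ⟨t, ht, hp⟩)
      · exact longPairs_antitone n (Nat.le_succ k) hp
      · have := shapePairs_subset_longPairs (by omega) hp
        rwa [Nat.add_sub_cancel' ht.le] at this
  rw [hunion, card_union_of_disjoint, card_biUnion]
  · intro a _ b _ hab
    rw [Function.onFun, disjoint_left]
    intro p hp hp'
    simp only [shapePairs, mem_filter] at hp hp'
    exact hab (hp.2.1.symm.trans hp'.2.1)
  · rw [disjoint_left]
    intro p hp hp'
    obtain ⟨t, ht, hp'⟩ := mem_biUnion.mp hp'
    rw [mem_range] at ht
    rw [mem_shapePairs (by omega), Nat.add_sub_cancel' ht.le] at hp'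
    have := (mem_longPairs.mp hp).2 (show k < k + 1 by omega) (show t < k + 1 by omega) hp'.2.2
    omega

/-! ### The weights `∏ i < k, (2m - 2i) / (2m - i)` and their sum -/

/-- The mean number of nodes lying on a cycle of length `k`, in a random binary functional graph
of size `2 * m`. -/
noncomputable def weight (m k : ℕ) : ℝ := ∏ i ∈ range k, ((2 * m - 2 * i : ℝ) / (2 * m - i))

lemma weight_zero (m : ℕ) : weight m 0 = 1 := by simp [weight]

lemma weight_succ (m k : ℕ) :
    weight m (k + 1) = weight m k * ((2 * m - 2 * k : ℝ) / (2 * m - k)) :=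
  prod_range_succ _ _

lemma weight_eq_zero {m k : ℕ} (h : m < k) : weight m k = 0 :=
  prod_eq_zero (mem_range.mpr h) (by simp)

lemma tendsto_weight (k : ℕ) : Tendsto (fun m => weight m k) atTop (𝓝 1) := by
  have h : ∀ i ∈ range k,
      Tendsto (fun m : ℕ => (2 * m - 2 * i : ℝ) / (2 * m - i)) atTop (𝓝 1) := by
    intro i _
    have hden : Tendsto (fun m : ℕ => (2 * m - i : ℝ)) atTop atTop :=
      tendsto_atTop_add_const_right _ (-(i : ℝ))
        (tendsto_natCast_atTop_atTop.const_mul_atTop (by norm_num : (0 : ℝ) < 2))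
    have h0 : Tendsto (fun m : ℕ => 1 - (i : ℝ) / (2 * m - i)) atTop (𝓝 (1 - 0)) :=
      tendsto_const_nhds.sub (hden.const_div_atTop _)
    rw [sub_zero] at h0
    refine h0.congr' ?_
    filter_upwards [hden.eventually_gt_atTop 0] with m hm
    field_simp
    ring
  simpa [weight] using tendsto_finsetProd (range k) h

/-- The new factor `(2m - 2k) / (2m - k)` is twice the ratio of `(2m - k - 1).choose m` to `(2m -
k).choose m`, so the product telescopes. -/
lemma weight_mul_centralBinom {m k : ℕ} (h : k ≤ m) :
    weight m k * m.centralBinom = 2 ^ k * ((2 * m - k).choose m : ℝ) := by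
  induction k with
  | zero => simp [weight_zero, Nat.centralBinom]
  | succ k ih =>
    have hN : 2 * m - k = (2 * m - (k + 1)) + 1 := by omega
    have hch := Nat.choose_mul_succ_eq (2 * m - (k + 1)) m
    rw [← hN, show 2 * m - k - m = m - k by omega] at hch
    have hch' : ((2 * m - (k + 1)).choose m : ℝ) * (2 * m - k) =
        (2 * m - k).choose m * (m - k) := by
      have := congrArg (Nat.cast : ℕ → ℝ) hch
      push_cast [Nat.cast_sub (show k ≤ 2 * m by omega), Nat.cast_sub (show k ≤ m by omega)] at this
      exact this
    have hkm : (k : ℝ) + 1 ≤ m := by exact_mod_cast h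
    have hpos : (2 * m - k : ℝ) ≠ 0 := by
      have : (0 : ℝ) ≤ k := k.cast_nonneg
      linarith
    rw [weight_succ, mul_right_comm, ih (by omega), ← mul_div_assoc, div_eq_iff hpos, mul_assoc,
      mul_assoc, hch']
    ring

/-- Pascal's rule for partial sums, with the boundary term kept. -/
lemma sum_choose_div_two_pow_succ (m N : ℕ) :
    ∑ i ∈ range (N + 1), ((m + 1 + i).choose i : ℝ) / 2 ^ i =
      2 * ∑ i ∈ range (N + 1), ((m + i).choose i : ℝ) / 2 ^ i -
        ((m + 1 + N).choose N : ℝ) / 2 ^ N := by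
  induction N with
  | zero => norm_num
  | succ N ih =>
    rw [sum_range_succ, ih, sum_range_succ _ (N + 1)]
    have : (m + 1 + (N + 1)).choose (N + 1) =
        (m + 1 + N).choose N + (m + (N + 1)).choose (N + 1) := by
      rw [← add_assoc, Nat.choose_succ_succ, show m + 1 + N = m + (N + 1) by ring]
    rw [this]
    push_cast
    field_simp
    ring

/-- Raising `m` doubles the sum: at `N = m + 1` the extra summand and the boundary term cancel,
because `(2m + 2).choose (m + 1)` is twice `(2m + 1).choose (m + 1)`. -/
lemma sum_choose_div_two_pow (m : ℕ) :
    ∑ i ∈ range (m + 1), ((m + i).choose i : ℝ) / 2 ^ i = 2 ^ m := by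
  induction m with
  | zero => simp
  | succ m ih =>
    have : ((m + 1 + (m + 1)).choose (m + 1) : ℝ) = 2 * (m + (m + 1)).choose (m + 1) := by
      have h1 := Nat.choose_succ_succ (m + (m + 1)) m
      have h2 : (m + (m + 1)).choose m = (m + (m + 1)).choose (m + 1) :=
        Nat.choose_symm_of_eq_add rfl
      rw [h2, show (m + (m + 1)).succ = m + 1 + (m + 1) by omega] at h1
      rw [h1]
      push_cast
      ring
    rw [sum_choose_div_two_pow_succ, sum_range_succ, ih, this, pow_succ 2 m]
    field_simp
    ring

lemma sum_weight {m N : ℕ} (h : m < N) :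
    ∑ k ∈ range N, weight m k = 4 ^ m / m.centralBinom := by
  have hC : (m.centralBinom : ℝ) ≠ 0 := by exact_mod_cast m.centralBinom_ne_zero
  have htrunc : ∑ k ∈ range N, weight m k = ∑ k ∈ range (m + 1), weight m k := by
    symm
    refine sum_subset (range_subset_range.mpr h) fun k _ hk => weight_eq_zero ?_
    simpa [Nat.lt_succ_iff] using hk
  rw [htrunc, eq_div_iff hC, sum_mul,
    sum_congr rfl fun k hk => weight_mul_centralBinom (Nat.lt_succ_iff.mp (mem_range.mp hk)),
    ← sum_range_reflect, show (4 : ℝ) ^ m = 2 ^ m * 2 ^ m by rw [← mul_pow]; norm_num]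
  -- The rewrite turns both factors `2 ^ m` into sums; `sum_mul` expands the first, and the last
  -- line folds the second back.
  conv_rhs => rw [← sum_choose_div_two_pow m, sum_mul]
  refine sum_congr rfl fun i hi => ?_
  have hi' : i ≤ m := Nat.lt_succ_iff.mp (mem_range.mp hi)
  rw [show m + 1 - 1 - i = m - i by omega, show 2 * m - (m - i) = m + i by omega,
    Nat.choose_symm_add, pow_sub₀ _ two_ne_zero hi']
  field_simp
  rw [sum_choose_div_two_pow, mul_comm]

/-! ### Asymptotics -/

lemma sq_four_pow_div_centralBinom (m : ℕ) :
    (4 ^ m / m.centralBinom : ℝ) ^ 2 = Real.Wallis.W m * (2 * m + 1) := by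
  have hc : (m.centralBinom : ℝ) * (m.factorial * m.factorial) = (2 * m).factorial := by
    have := Nat.choose_mul_factorial_mul_factorial (show m ≤ 2 * m by omega)
    rw [show 2 * m - m = m by omega, mul_assoc] at this
    exact_mod_cast this
  have hC : (m.centralBinom : ℝ) ≠ 0 := by exact_mod_cast m.centralBinom_ne_zero
  have hf : (m.factorial : ℝ) ≠ 0 := by exact_mod_cast m.factorial_ne_zero
  rw [Real.Wallis.W_eq_factorial_ratio, ← hc, show (4 : ℝ) = 2 ^ 2 by norm_num, ← pow_mul]
  have h2 : (2 * m + 1 : ℝ) ≠ 0 := by positivity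
  field_simp
  ring

/-- An equivalence would not give the second-order terms. With `a` the quotient and `s = √(π m)`,
the two Wallis bounds give `0 ≤ a ^ 2 - s ^ 2 ≤ π / 2`, hence `0 ≤ a - s ≤ (π / 2) / s`. -/
lemma tendsto_four_pow_div_centralBinom_sub :
    Tendsto (fun m : ℕ => (4 ^ m / m.centralBinom : ℝ) - √(Real.pi * m)) atTop (𝓝 0) := by
  have hs : Tendsto (fun m : ℕ => √(Real.pi * m)) atTop atTop :=
    Real.tendsto_sqrt_atTop.comp (tendsto_natCast_atTop_atTop.const_mul_atTop Real.pi_pos)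
  have hsq : ∀ m : ℕ, √(Real.pi * m) ^ 2 = Real.pi * m :=
    fun m => Real.sq_sqrt (by positivity)
  have hle : ∀ m : ℕ, √(Real.pi * m) ≤ 4 ^ m / m.centralBinom := by
    intro m
    refine Real.sqrt_le_iff.mpr ⟨by positivity, ?_⟩
    rw [sq_four_pow_div_centralBinom]
    have h1 := mul_le_mul_of_nonneg_right (Real.Wallis.le_W m)
      (show (0 : ℝ) ≤ 2 * m + 1 by positivity)
    refine le_trans ?_ h1
    rw [div_mul_eq_mul_div, div_mul_eq_mul_div, le_div_iff₀ (by positivity)]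
    nlinarith [Real.pi_pos]
  refine squeeze_zero' (g := fun m : ℕ => (Real.pi / 2) / √(Real.pi * m))
    (Eventually.of_forall fun m => sub_nonneg.mpr (hle m)) ?_ (hs.const_div_atTop _)
  filter_upwards [hs.eventually_gt_atTop 0] with m hm
  rw [le_div_iff₀ hm]
  have h1 := mul_le_mul_of_nonneg_right (Real.Wallis.W_le m)
    (show (0 : ℝ) ≤ 2 * m + 1 by positivity)
  rw [← sq_four_pow_div_centralBinom] at h1
  nlinarith [hle m, hsq m, mul_nonneg (sub_nonneg.mpr (hle m)) (hm.le.trans (hle m))]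

lemma tendsto_evenAtTop {F : ℕ → ℝ} {l : Filter ℝ}
    (h : Tendsto (fun m => F (2 * m)) atTop l) : Tendsto F evenAtTop l := by
  have hle : evenAtTop ≤ map (fun m => 2 * m) atTop := by
    intro s hs
    obtain ⟨M, hM⟩ := mem_atTop_sets.mp (mem_map.mp hs)
    refine mem_inf_principal.mpr ?_
    filter_upwards [eventually_ge_atTop (2 * M)] with n hn he
    obtain ⟨m, rfl⟩ := he.two_dvd
    exact hM m (by omega)
  exact (tendsto_map'_iff.mpr h).mono_left hle

/-- A function at bounded limiting distance from `√(π n / 2)` is equivalent to every shift of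
`√(π n / 2)`. -/
lemma isEquivalent_sqrt_add {u : ℕ → ℝ} {a c : ℝ}
    (h : Tendsto (fun n : ℕ => u n - (√(Real.pi * n / 2) + a)) evenAtTop (𝓝 c)) :
    u ~[evenAtTop] fun n : ℕ => √(Real.pi * n / 2) + a := by
  have hs : Tendsto (fun n : ℕ => √(Real.pi * n / 2) + a) evenAtTop atTop := by
    refine tendsto_atTop_add_const_right _ _ (Tendsto.mono_left ?_ inf_le_left)
    exact Real.tendsto_sqrt_atTop.comp
      ((tendsto_natCast_atTop_atTop.const_mul_atTop Real.pi_pos).atTop_div_const two_pos)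
  exact (h.isBigO_one ℝ).trans_isLittleO
    ((isLittleO_one_left_iff ℝ).mpr (tendsto_norm_atTop_atTop.comp hs))

/-! ### Means of the numbers of nodes of given shape -/

lemma le_of_mem_longPairs {n k : ℕ} {p : (Fin n → Fin n) × Fin n} (hp : p ∈ longPairs n k) :
    k ≤ n := by
  have := card_notMem_orbit (mem_longPairs.mp hp).2
  omega

lemma card_shapePairs_eq_zero {n t c : ℕ} (hc : 0 < c) (h : n < t + c) :
    (shapePairs n t c).card = 0 := by
  rw [card_eq_zero, eq_empty_iff_forall_notMem]
  intro p hp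
  have := le_of_mem_longPairs (shapePairs_subset_longPairs hc hp)
  omega

lemma card_shapePairs_cycle_zero (n t : ℕ) : (shapePairs n t 0).card = 0 := by
  rw [card_eq_zero, shapePairs, filter_eq_empty_iff]
  rintro p _ ⟨_, h⟩
  exact (cycleLength_pos p.1 p.2).ne' h

/-- The `k` shapes with positive tail and total length `k + 1` are equinumerous, so the splitting of
`L (k+1)` reads `(n-k) * N * w k = L (k+2) + S 0 (k+1) + k * N * w k`. Since `L (k+2) = (n-k-1) * S
0 (k+1)`, this gives `S 0 (k+1) = N * w k * (n-2k) / (n-k)`, the next weight. -/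
lemma card_longPairs {m k : ℕ} (hk : k < 2 * m) :
    ((longPairs (2 * m) (k + 1)).card : ℝ) =
      (2 * m - k) * ((graphs (2 * m)).card * weight m k) := by
  induction k with
  | zero => rw [card_longPairs_one, weight_zero]; push_cast; ring
  | succ k ih =>
    have hk' : (k : ℝ) + 1 < 2 * m := by exact_mod_cast hk
    have h1 : (2 * m - k : ℝ) ≠ 0 := by linarith
    have hrec := congrArg (Nat.cast : ℕ → ℝ) (card_longPairs_eq (2 * m) (k + 1))
    rw [sum_range_succ'] at hrec
    push_cast at hrec
    have hb : ∀ t ∈ range k, ((shapePairs (2 * m) (t + 1) (k - t)).card : ℝ) =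
        (graphs (2 * m)).card * weight m k := by
      intro t ht
      obtain ⟨c, rfl⟩ : ∃ c, k = t + c + 1 := ⟨k - t - 1, by have := mem_range.mp ht; omega⟩
      have h := card_shapePairs_succ_mul (2 * m) t c
      rw [show t + c + 2 = t + c + 1 + 1 by ring, ih (by omega)] at h
      rw [show t + c + 1 - t = c + 1 by omega]
      push_cast at h h1
      rw [mul_comm] at h
      exact mul_left_cancel₀ h1 h
    have h0 := card_shapePairs_zero_mul (2 * m) k
    rw [sum_congr rfl hb, sum_const, card_range, nsmul_eq_mul, ih (by omega),
      ← mul_right_cancel_iff_of_pos (show (0 : ℝ) < 2 * m - (k + 1) by linarith)]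
      at hrec
    push_cast at h0
    rw [add_mul _ (_ + _), add_mul _ ((shapePairs _ _ _).card : ℝ), h0] at hrec
    rw [weight_succ]
    push_cast
    rw [← mul_left_cancel_iff_of_pos (show (0 : ℝ) < 2 * m - k by linarith)]
    field_simp
    linear_combination -hrec

lemma card_shapePairs_zero {m : ℕ} (hm : 2 ≤ m) (c : ℕ) :
    ((shapePairs (2 * m) 0 (c + 1)).card : ℝ) = (graphs (2 * m)).card * weight m (c + 1) := by
  rcases lt_or_ge (c + 1) (2 * m) with h | h
  · have h0 := card_shapePairs_zero_mul (2 * m) c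
    rw [card_longPairs h] at h0
    have h' : (c : ℝ) + 1 < 2 * m := by exact_mod_cast h
    push_cast at h0
    rw [mul_comm] at h0
    exact mul_left_cancel₀ (by linarith) h0
  -- At `c + 1 = 2 * m` the multiplier in `card_shapePairs_zero_mul` vanishes, so the count is
  -- instead shown to be zero: no orbit has `2 * m` distinct nodes once `m < 2 * m - 1`.
  · have hd : (longPairs (2 * m) (c + 1)).card = 0 := by
      have h1 := card_longPairs (show 2 * m - 1 < 2 * m by omega)
      rw [weight_eq_zero (show m < 2 * m - 1 by omega), mul_zero, mul_zero,
        show 2 * m - 1 + 1 = 2 * m by omega] at h1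
      exact Nat.eq_zero_of_le_zero
        ((card_le_card (longPairs_antitone _ h)).trans (by exact_mod_cast h1.le))
    have hb : (shapePairs (2 * m) 0 (c + 1)).card = 0 := by
      have := card_le_card (shapePairs_subset_longPairs (n := 2 * m) (t := 0) c.succ_pos)
      rw [zero_add, Nat.succ_eq_add_one, hd] at this
      exact Nat.eq_zero_of_le_zero this
    rw [hb, weight_eq_zero (by omega)]
    simp

lemma card_shapePairs_succ {m : ℕ} (hm : 2 ≤ m) (t c : ℕ) :
    ((shapePairs (2 * m) (t + 1) (c + 1)).card : ℝ) =
      (graphs (2 * m)).card * weight m (t + c + 1) := by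
  rcases lt_or_ge (t + c + 1) (2 * m) with h | h
  · have h0 := card_shapePairs_succ_mul (2 * m) t c
    rw [show t + c + 2 = t + c + 1 + 1 by ring, card_longPairs h] at h0
    have h' : (t : ℝ) + c + 1 < 2 * m := by exact_mod_cast h
    push_cast at h0
    rw [mul_comm] at h0
    exact mul_left_cancel₀ (by linarith) h0
  · rw [card_shapePairs_eq_zero c.succ_pos (by omega), weight_eq_zero (by omega)]
    simp

lemma tailLength_add_cycleLength_le {n : ℕ} (f : Fin n → Fin n) (x : Fin n) :
    tailLength f x + cycleLength f x ≤ n := by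
  have := card_notMem_orbit ((tail_cycle_iff f x (cycleLength_pos f x)).mp ⟨rfl, rfl⟩).1
  omega

/-- The mean of a count that splits according to tail and cycle lengths. -/
lemma mean_eq_sum_shapePairs {n N : ℕ} {X : (Fin n → Fin n) → ℕ} (t c : ℕ → ℕ)
    (h : ∀ f, X f = ∑ j ∈ range N,
      (univ.filter fun x => tailLength f x = t j ∧ cycleLength f x = c j).card) :
    mean n X = (∑ j ∈ range N, ((shapePairs n (t j) (c j)).card : ℝ)) / (graphs n).card := by
  have hcard : ∀ a b : ℕ, (shapePairs n a b).card = ∑ f ∈ graphs n,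
      (univ.filter fun x => tailLength f x = a ∧ cycleLength f x = b).card := by
    intro a b
    simp only [shapePairs, card_filter, sum_product]
  unfold mean
  congr 1
  simp only [h, hcard]
  push_cast
  exact sum_comm

lemma mean_cycleCount_succ {m : ℕ} (hm : 2 ≤ m) (s : ℕ) :
    mean (2 * m) (cycleCount (s + 1)) =
      4 ^ m / m.centralBinom - ∑ k ∈ range (s + 1), weight m k + weight m (s + 1) := by
  have hg : ((graphs (2 * m)).card : ℝ) ≠ 0 := by
    exact_mod_cast (graphs_two_mul_nonempty m).card_pos.ne'
  rw [mean_eq_sum_shapePairs (N := 2 * m + 1) (fun t => t) (fun _ => s + 1)]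
  -- Tail length `0` contributes the separate `weight m (s + 1)`. The full sum is cut at `s + 1 + 2
  -- * m` so that `sum_range_add` removes exactly the first `s + 1` weights.
  · rw [sum_range_succ', card_shapePairs_zero hm,
      sum_congr rfl fun t _ => card_shapePairs_succ hm t s,
      ← sum_weight (show m < s + 1 + 2 * m by omega), sum_range_add, ← mul_sum, ← mul_add,
      mul_div_cancel_left₀ _ hg, add_sub_cancel_left]
    congr 1
    exact sum_congr rfl fun t _ => congrArg _ (by ring)
  · intro f
    rw [cycleCount, card_eq_sum_card_fiberwise (f := tailLength f) (t := range (2 * m + 1))]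
    · simp only [filter_filter, and_comm]
    · intro x _
      have := tailLength_add_cycleLength_le f x
      simp only [coe_range, Set.mem_Iio]
      omega

lemma tailCount_eq_sum (r : ℕ) {n : ℕ} (f : Fin n → Fin n) :
    tailCount r f = ∑ c ∈ range (n + 1),
      (univ.filter fun x => tailLength f x = r ∧ cycleLength f x = c).card := by
  rw [tailCount, card_eq_sum_card_fiberwise (f := cycleLength f) (t := range (n + 1))]
  · simp only [filter_filter]
  · intro x _
    have := tailLength_add_cycleLength_le f x
    simp only [coe_range, Set.mem_Iio]
    omega

lemma mean_tailCount_zero {m : ℕ} (hm : 2 ≤ m) :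
    mean (2 * m) (tailCount 0) = 4 ^ m / m.centralBinom - 1 := by
  have hg : ((graphs (2 * m)).card : ℝ) ≠ 0 := by
    exact_mod_cast (graphs_two_mul_nonempty m).card_pos.ne'
  rw [mean_eq_sum_shapePairs (fun _ => 0) (fun c => c) (tailCount_eq_sum 0), sum_range_succ',
    card_shapePairs_cycle_zero, sum_congr rfl fun c _ => card_shapePairs_zero hm c,
    ← sum_weight (show m < 2 * m + 1 by omega), sum_range_succ', weight_zero, ← mul_sum,
    Nat.cast_zero, add_zero, mul_div_cancel_left₀ _ hg, add_sub_cancel_right]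

lemma mean_tailCount_succ {m : ℕ} (hm : 2 ≤ m) (s : ℕ) :
    mean (2 * m) (tailCount (s + 1)) =
      4 ^ m / m.centralBinom - ∑ k ∈ range (s + 1), weight m k := by
  have hg : ((graphs (2 * m)).card : ℝ) ≠ 0 := by
    exact_mod_cast (graphs_two_mul_nonempty m).card_pos.ne'
  rw [mean_eq_sum_shapePairs (fun _ => s + 1) (fun c => c) (tailCount_eq_sum (s + 1)),
    sum_range_succ', card_shapePairs_cycle_zero,
    sum_congr rfl fun c _ => card_shapePairs_succ hm s c,
    ← sum_weight (show m < s + 1 + 2 * m by omega), sum_range_add, ← mul_sum,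
    Nat.cast_zero, add_zero, mul_div_cancel_left₀ _ hg, add_sub_cancel_left]
  exact sum_congr rfl fun t _ => congrArg _ (by ring)

lemma rhoCount_eq_sum (r : ℕ) {n : ℕ} (f : Fin n → Fin n) :
    rhoCount r f = ∑ t ∈ range (r + 1),
      (univ.filter fun x => tailLength f x = t ∧ cycleLength f x = r - t).card := by
  rw [rhoCount, card_eq_sum_card_fiberwise (f := tailLength f) (t := range (r + 1))]
  · refine sum_congr rfl fun t ht => ?_
    rw [filter_filter]
    congr 1
    ext x
    have := mem_range.mp ht
    simp only [mem_filter, mem_univ, true_and]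
    unfold rhoLength
    omega
  · intro x hx
    simp only [mem_coe, mem_filter, mem_univ, true_and] at hx
    unfold rhoLength at hx
    simp only [coe_range, Set.mem_Iio]
    omega

lemma mean_rhoCount_zero (m : ℕ) : mean (2 * m) (rhoCount 0) = 0 := by
  rw [mean_eq_sum_shapePairs (fun t => t) (fun t => 0 - t) (rhoCount_eq_sum 0)]
  simp [card_shapePairs_cycle_zero]

lemma mean_rhoCount_succ {m : ℕ} (hm : 2 ≤ m) (s : ℕ) :
    mean (2 * m) (rhoCount (s + 1)) = s * weight m s + weight m (s + 1) := by
  have hg : ((graphs (2 * m)).card : ℝ) ≠ 0 := by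
    exact_mod_cast (graphs_two_mul_nonempty m).card_pos.ne'
  have hb : ∀ t ∈ range s, ((shapePairs (2 * m) (t + 1) (s + 1 - (t + 1))).card : ℝ) =
      (graphs (2 * m)).card * weight m s := by
    intro t ht
    obtain ⟨c, rfl⟩ : ∃ c, s = t + c + 1 := ⟨s - t - 1, by have := mem_range.mp ht; omega⟩
    rw [show t + c + 1 + 1 - (t + 1) = c + 1 by omega, card_shapePairs_succ hm]
  -- Tail length `0` gives `weight m (s + 1)`, each of `1, …, s` gives `weight m s`, and `s + 1`
  -- would need an empty cycle.
  rw [mean_eq_sum_shapePairs (fun t => t) (fun t => s + 1 - t) (rhoCount_eq_sum (s + 1)),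
    sum_range_succ', Nat.sub_zero, card_shapePairs_zero hm, sum_range_succ, Nat.sub_self,
    card_shapePairs_cycle_zero, sum_congr rfl hb, sum_const, card_range, nsmul_eq_mul,
    Nat.cast_zero, add_zero, div_eq_iff hg]
  ring

/-! ### Limits of the means -/

lemma tendsto_sum_weight (r : ℕ) :
    Tendsto (fun m => ∑ k ∈ range r, weight m k) atTop (𝓝 (r : ℝ)) := by
  simpa using tendsto_finsetSum (range r) fun k _ => tendsto_weight k

lemma sqrt_pi_two_mul_div_two (m : ℕ) : √(Real.pi * (2 * m : ℕ) / 2) = √(Real.pi * m) := by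
  congr 1
  push_cast
  ring

lemma tendsto_mean_cycleCount_sub (s : ℕ) :
    Tendsto (fun n : ℕ => mean n (cycleCount (s + 1)) - √(Real.pi * n / 2)) evenAtTop
      (𝓝 (-(s : ℝ))) := by
  apply tendsto_evenAtTop
  have h := (tendsto_four_pow_div_centralBinom_sub.sub (tendsto_sum_weight (s + 1))).add
    (tendsto_weight (s + 1))
  rw [show (0 : ℝ) - (s + 1 : ℕ) + 1 = -s by push_cast; ring] at h
  refine h.congr' ?_
  filter_upwards [eventually_ge_atTop 2] with m hm
  rw [mean_cycleCount_succ hm, sqrt_pi_two_mul_div_two]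
  ring

lemma tendsto_mean_tailCount_succ_sub (s : ℕ) :
    Tendsto (fun n : ℕ => mean n (tailCount (s + 1)) - √(Real.pi * n / 2)) evenAtTop
      (𝓝 (-((s + 1 : ℕ) : ℝ))) := by
  apply tendsto_evenAtTop
  have h := tendsto_four_pow_div_centralBinom_sub.sub (tendsto_sum_weight (s + 1))
  rw [zero_sub] at h
  refine h.congr' ?_
  filter_upwards [eventually_ge_atTop 2] with m hm
  rw [mean_tailCount_succ hm, sqrt_pi_two_mul_div_two]
  ring

lemma tendsto_mean_tailCount_zero_sub :
    Tendsto (fun n : ℕ => mean n (tailCount 0) - √(Real.pi * n / 2)) evenAtTop (𝓝 (-1)) := by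
  apply tendsto_evenAtTop
  have h := tendsto_four_pow_div_centralBinom_sub.sub_const 1
  rw [zero_sub] at h
  refine h.congr' ?_
  filter_upwards [eventually_ge_atTop 2] with m hm
  rw [mean_tailCount_zero hm, sqrt_pi_two_mul_div_two]
  ring

lemma tendsto_mean_rhoCount (r : ℕ) :
    Tendsto (fun n : ℕ => mean n (rhoCount r)) evenAtTop (𝓝 (r : ℝ)) := by
  apply tendsto_evenAtTop
  cases r with
  | zero => simp [mean_rhoCount_zero]
  | succ s =>
    have h := ((tendsto_weight s).const_mul (s : ℝ)).add (tendsto_weight (s + 1))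
    rw [mul_one, ← Nat.cast_succ] at h
    refine h.congr' ?_
    filter_upwards [eventually_ge_atTop 2] with m hm
    rw [mean_rhoCount_succ hm]

lemma exists_tendsto_mean_tailCount_sub (r : ℕ) : ∃ c : ℝ,
    Tendsto (fun n : ℕ => mean n (tailCount r) - √(Real.pi * n / 2)) evenAtTop (𝓝 c) := by
  cases r with
  | zero => exact ⟨_, tendsto_mean_tailCount_zero_sub⟩
  | succ s => exact ⟨_, tendsto_mean_tailCount_succ_sub s⟩

end BinaryFunctionalGraph

open BinaryFunctionalGraph in
theorem theorem6 (r : ℕ) :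
    -- cycle lengths of size `r`
    (1 ≤ r →
      ((fun n : ℕ => mean n (cycleCount r)) ~[evenAtTop]
          fun n : ℕ => √(Real.pi * n / 2) - r) ∧
      Tendsto (fun n : ℕ => mean n (cycleCount r) - (√(Real.pi * n / 2) - r + 1))
        evenAtTop (𝓝 0)) ∧
    -- tail lengths of size `r`
    ((fun n : ℕ => mean n (tailCount r)) ~[evenAtTop]
        fun n : ℕ => √(Real.pi * n / 2) - r + 1) ∧
    (1 ≤ r →
      Tendsto (fun n : ℕ => mean n (tailCount r) - (√(Real.pi * n / 2) - r))
        evenAtTop (𝓝 0)) ∧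
    -- rho lengths of size `r`
    Tendsto (fun n : ℕ => mean n (rhoCount r)) evenAtTop (𝓝 (r : ℝ)) := by
  refine ⟨fun hr => ?_, ?_, fun hr => ?_, tendsto_mean_rhoCount r⟩
  · obtain ⟨s, rfl⟩ := Nat.exists_eq_add_of_le' hr
    have h := tendsto_mean_cycleCount_sub s
    constructor
    · simp only [sub_eq_add_neg]
      refine isEquivalent_sqrt_add (c := 1) ?_
      convert h.add_const ((s + 1 : ℕ) : ℝ) using 2
      · ring
      · push_cast; ring
    · convert h.add_const (s : ℝ) using 2
      · push_cast; ring
      · ring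
  -- The first-order claim needs only some finite limit, which covers `r = 0` and `r ≥ 1` together
  -- although their constants follow different formulas.
  · obtain ⟨c, h⟩ := exists_tendsto_mean_tailCount_sub r
    simp only [sub_add]
    simp only [sub_eq_add_neg (√_)]
    refine isEquivalent_sqrt_add (c := c + (r - 1)) ?_
    convert h.add_const ((r : ℝ) - 1) using 2
    ring
  · obtain ⟨s, rfl⟩ := Nat.exists_eq_add_of_le' hr
    convert (tendsto_mean_tailCount_succ_sub s).add_const ((s + 1 : ℕ) : ℝ) using 2
    · ring
    · ring
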